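/- A geodesic metric space $(X,d)$ is CAT$(-1)$ if for every geodesic triangle in $X$, the distance between any two points of the triangle is at most the distance between the corresponding points of its comparison triangle in the hyperbolic plane $\mathbb{H}^2$. Such a space is uniquely geodesic; $[x,y]$ denotes the geodesic from $x$ to $y$ and, when $X$ is proper, $\pi_{[x,y]}(w)$ the unique point of $[x,y]$ closest to $w$, and $\partial X$ the Gromov boundary. For $w,x,y,v\in X$ and $K\ge 0$, the sequence $(w,[x,y],v)$ is called $K$-aligned if $d(\pi_{[x,y]}(w),x)<K$ and $d(\pi_{[x,y]}(v),y)<K$. Let $r\ge 1$, let $X_1,\dots,X_r$ be proper geodesic CAT$(-1)$ spaces, and put $Z=X_1\times\cdots\times X_r$, $\partial Z=\partial X_1\times\cdots\times\partial X_r$ and $\operatorname{Isom}(Z)=\operatorname{Isom}(X_1)\times\cdots\times\operatorname{Isom}(X_r)$. A sequence in $Z$ converges to $\xi=(\xi_1,\dots,\xi_r)\in\partial Z$ if for each $i$ its $i$-th component converges to $\xi_i$. The limit set $\Lambda(\Gamma)\subset\partial Z$ of $\Gamma<\operatorname{Isom}(Z)$ is the set of all accumulation points in $\partial Z$ of a $\Gamma$-orbit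 in $Z$. The subgroup $\Gamma$ is transverse if (divergent) for every sequence $(g_n)_{n\in\mathbb N}$ of pairwise distinct elements of $\Gamma$, every $z=(x_1,\dots,x_r)\in Z$ and every $1\le i\le r$, one has $d(g_{n,i}x_i,x_i)\to+\infty$ as $n\to+\infty$, where $g_{n,i}$ is the $i$-th component of $g_n$; and (antipodal) for any distinct $\xi,\zeta\in\Lambda(\Gamma)$, one has $\xi_i\ne\zeta_i$ for all $1\le i\le r$. Proposition. Let $\Gamma<\operatorname{Isom}(Z)$ be a transverse subgroup and let $z=(x_1,\dots,x_r)\in Z$. Then for every $K>0$ there is a constant $\widehat C>0$ such that the following holds. If $g=(g_1,\dots,g_r)$, $h=(h_1,\dots,h_r)$, $k=(k_1,\dots,k_r)\in\Gamma$ are such that $(x_1,[g_1x_1,h_1x_1],k_1x_1)$ is $K$-aligned, then $(z,[gz,hz],kz)$ is $\widehat C$-aligned, that is, $(x_i,[g_ix_i,h_ix_i],k_ix_i)$ is $\widehat C$-aligned for every $1\le i\le r$. -/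

import Mathlib

open Filter Set
open scoped NNReal

namespace CATProduct

/-! ### Geodesics and CAT(-1) spaces -/

/-- `γ`, restricted to `[0, d(x, y)]`, is a (unit speed) geodesic from `x` to `y`. -/
def IsGeodesic {X : Type*} [MetricSpace X] (x y : X) (γ : ℝ → X) : Prop :=
  γ 0 = x ∧ γ (dist x y) = y ∧
    ∀ s ∈ Icc (0 : ℝ) (dist x y), ∀ t ∈ Icc (0 : ℝ) (dist x y), dist (γ s) (γ t) = |s - t|

/-- `X` is a CAT(-1) space: a geodesic metric space in which every geodesic triangle is no fatter
than its comparison triangle in the hyperbolic plane (Mathlib's `UpperHalfPlane` carries the metric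
of constant curvature `-1`).

In `comparison`, `x, y, z` are the vertices of the triangle and `α, β` are its sides from `x` to `y`
and from `x` to `z`; `x', y', z'` and `α', β'` are the corresponding vertices and sides of a
comparison triangle; `α' s` and `β' t` are the comparison points of `α s` and `β t`. As the vertices
are arbitrary, this covers pairs of points on any two different sides (for two points on the same
side the inequality is an equality). -/
structure IsCATNegOne (X : Type*) [MetricSpace X] : Prop where
  geodesic : ∀ x y : X, ∃ γ : ℝ → X, IsGeodesic x y γ
  comparison : ∀ (x y z : X) (α β : ℝ → X), IsGeodesic x y α → IsGeodesic x z β →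
    ∀ (x' y' z' : UpperHalfPlane) (α' β' : ℝ → UpperHalfPlane),
      dist x' y' = dist x y → dist x' z' = dist x z → dist y' z' = dist y z →
      IsGeodesic x' y' α' → IsGeodesic x' z' β' →
      ∀ s ∈ Icc (0 : ℝ) (dist x y), ∀ t ∈ Icc (0 : ℝ) (dist x z),
        dist (α s) (β t) ≤ dist (α' s) (β' t)

/-- The geodesic segment `[x, y]`, as a set: the points on a geodesic from `x` to `y`. (In a
CAT(-1) space this geodesic is unique.) -/
def geodesicSegment {X : Type*} [MetricSpace X] (x y : X) : Set X :=
  {p | ∃ γ : ℝ → X, IsGeodesic x y γ ∧ ∃ t ∈ Icc (0 : ℝ) (dist x y), γ t = p}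

/-! ### Alignment -/

/-- `p` is a nearest point to `w` on `S`, i.e. `p = π_S(w)` when the nearest point is unique. -/
def IsNearestPoint {X : Type*} [MetricSpace X] (S : Set X) (w p : X) : Prop :=
  p ∈ S ∧ ∀ q ∈ S, dist w p ≤ dist w q

/-- `(w, [x, y])` is `K`-aligned: `d(π_{[x, y]}(w), x) < K`. -/
def AlignedLeft {X : Type*} [MetricSpace X] (K : ℝ) (w x y : X) : Prop :=
  ∃ p : X, IsNearestPoint (geodesicSegment x y) w p ∧ dist p x < K

/-- `(w, [x, y], z)` is `K`-aligned: `(w, [x, y])` is `K`-aligned and `([x, y], z)` is `K`-aligned,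
the latter meaning that `(z, [y, x])` is `K`-aligned. -/
def Aligned {X : Type*} [MetricSpace X] (K : ℝ) (w x y z : X) : Prop :=
  AlignedLeft K w x y ∧ AlignedLeft K z y x

/-! ### The Gromov boundary -/

/-- Geodesic rays `[0, ∞) → X`. -/
def GeodesicRay (X : Type*) [MetricSpace X] : Type _ := {γ : ℝ≥0 → X // Isometry γ}

/-- Two geodesic rays are asymptotic if they stay within bounded distance. -/
def rayAsymptotic (X : Type*) [MetricSpace X] : Setoid (GeodesicRay X) where
  r γ γ' := ∃ C : ℝ, ∀ t : ℝ≥0, dist (γ.1 t) (γ'.1 t) ≤ C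
  iseqv :=
    { refl := fun _ => ⟨0, fun _ => by simp⟩
      symm := fun ⟨C, hC⟩ => ⟨C, fun t => by rw [dist_comm]; exact hC t⟩
      trans := fun ⟨C, hC⟩ ⟨D, hD⟩ =>
        ⟨C + D, fun t => (dist_triangle _ _ _).trans (add_le_add (hC t) (hD t))⟩ }

/-- The Gromov boundary `∂X`: geodesic rays up to bounded distance. -/
def Boundary (X : Type*) [MetricSpace X] : Type _ := Quotient (rayAsymptotic X)

/-- The Gromov product `(x | y)_o`. -/
noncomputable def gromovProduct {X : Type*} [MetricSpace X] (o x y : X) : ℝ :=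
  (dist o x + dist o y - dist x y) / 2

/-- The sequence `u` in `X` converges to `ξ ∈ ∂X`: for the rays `γ` in the class `ξ`, the Gromov
product `(u n | γ t)_o` tends to infinity as `n, t → ∞`. (A change of `o` or of `γ` within its class
changes the Gromov products by a bounded amount only.) -/
def ConvergesTo {X : Type*} [MetricSpace X] (u : ℕ → X) (ξ : Boundary X) : Prop :=
  ∀ (o : X) (γ : GeodesicRay X), Quotient.mk (rayAsymptotic X) γ = ξ →
    Tendsto (fun p : ℕ × ℝ≥0 => gromovProduct o (u p.1) (γ.1 p.2)) (atTop ×ˢ atTop) atTop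

/-! ### Products and transverse subgroups -/

section Product

variable {r : ℕ} {X : Fin r → Type*} [∀ i, MetricSpace (X i)]

/-- The limit set `Λ(Γ) ⊆ ∂Z = ∏ ∂X_i` of a subgroup `Γ` of `Isom(Z) = ∏ Isom(X_i)`: the
accumulation points in `∂Z` of a `Γ`-orbit in `Z = ∏ X_i`, where convergence to a point of `∂Z` is
convergence in each component. -/
def limitSet (Γ : Subgroup (∀ i, X i ≃ᵢ X i)) : Set (∀ i, Boundary (X i)) :=
  {ξ | ∃ (z : ∀ i, X i) (g : ℕ → ∀ i, X i ≃ᵢ X i), (∀ n, g n ∈ Γ) ∧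
    ∀ i, ConvergesTo (fun n => g n i (z i)) (ξ i)}

/-- Transverse subgroups of `Isom(Z)`. (Infinite sequences are sequences of pairwise distinct
elements. By divergence, the action of such a subgroup on `Z` is proper when `Z` is proper.) -/
structure IsTransverse (Γ : Subgroup (∀ i, X i ≃ᵢ X i)) : Prop where
  divergent : ∀ g : ℕ → ∀ i, X i ≃ᵢ X i, (∀ n, g n ∈ Γ) → Function.Injective g →
    ∀ (z : ∀ i, X i) (i : Fin r), Tendsto (fun n => dist (g n i (z i)) (z i)) atTop atTop
  antipodal : ∀ ξ ∈ limitSet Γ, ∀ ζ ∈ limitSet Γ, ξ ≠ ζ → ∀ i, ξ i ≠ ζ i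

/-- `(w, [x, y], z)` is `K`-aligned, for `w, x, y, z` in the product `Z`: each of its components
is `K`-aligned. -/
def ProdAligned (K : ℝ) (w x y z : ∀ i, X i) : Prop :=
  ∀ i, Aligned K (w i) (x i) (y i) (z i)

end Product

end CATProduct

/-! Alignment of `(w, [x, y])` amounts, up to constants, to a bound on the Gromov product `(w |
y)_x`. Translating `x` to the base point by an element of `Γ`, the theorem becomes: if `(a z | b
z)_z` is bounded in one factor, for `a`, `b` in `Γ`, it is bounded in all
(`IsTransverse.exists_gromovProduct_le`). Otherwise there are `a n`, `b n` whose product is bounded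
in factor `i₀` but tends to infinity in factor `i`. By divergence both orbits go to infinity in
every factor, so after extraction they converge to limit points `ξ`, `ζ`. The bound in factor `i₀`
forces `ξ ≠ ζ`, the growth in factor `i` forces `ξ i = ζ i`, and antipodality is violated. Curvature
enters mostly through thinness of triangles (`IsCATNegOne.dist_le_one`), which gives the four-point
inequality with constant 1. -/

namespace CATProduct

/-! ### Thin triangles in the hyperbolic plane -/

/-- The rotation of the hyperbolic plane about `i` with matrix `!![c, s; -s, c]`. -/
noncomputable def rotation (c s : ℝ) (h : c ^ 2 + s ^ 2 = 1) : Matrix.SpecialLinearGroup (Fin 2) ℝ :=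
  ⟨!![c, s; -s, c], by rw [Matrix.det_fin_two_of]; linarith⟩

/-- The upward geodesic line through `i` in the hyperbolic plane. -/
noncomputable def verticalLine (t : ℝ) : UpperHalfPlane :=
  UpperHalfPlane.mk ⟨0, Real.exp t⟩ (Real.exp_pos t)

theorem isometry_verticalLine : Isometry verticalLine :=
  UpperHalfPlane.isometry_vertical_line 0

theorem _root_.Isometry.isGeodesic {Y : Type*} [MetricSpace Y] {γ : ℝ → Y} (hγ : Isometry γ)
    {a : ℝ} (ha : 0 ≤ a) : IsGeodesic (γ 0) (γ a) γ := by
  have h : dist (γ 0) (γ a) = a := by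
    rw [hγ.dist_eq, Real.dist_eq, zero_sub, abs_neg, abs_of_nonneg ha]
  exact ⟨rfl, by rw [h], fun s _ t _ => by rw [hγ.dist_eq, Real.dist_eq]⟩

theorem rotation_smul_verticalLine_zero (c s : ℝ) (h : c ^ 2 + s ^ 2 = 1) :
    rotation c s h • verticalLine 0 = verticalLine 0 := by
  have hd : -((s : ℂ) * Complex.I) + c ≠ 0 := by
    intro h0
    have h1 := congrArg Complex.re h0
    have h2 := congrArg Complex.im h0
    simp at h1 h2
    simp [h1, h2] at h
  have hi : (⟨0, 1⟩ : ℂ) = Complex.I := rfl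
  apply UpperHalfPlane.ext
  rw [UpperHalfPlane.coe_specialLinearGroup_apply]
  simp [rotation, verticalLine, hi]
  rw [div_eq_iff hd]
  linear_combination (s : ℂ) * Complex.I_mul_I

/-- The hyperbolic law of cosines for the angle `θ` with `c = cos (θ/2)`, `s = sin (θ/2)`. -/
theorem cosh_dist_rotation (c s : ℝ) (h : c ^ 2 + s ^ 2 = 1) (u v : ℝ) :
    Real.cosh (dist (verticalLine u) (rotation c s h • verticalLine v)) =
      c ^ 2 * Real.cosh (u - v) + s ^ 2 * Real.cosh (u + v) := by
  have hu := Real.exp_pos u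
  have hv := Real.exp_pos v
  have hD : 0 < c ^ 2 + s ^ 2 * Real.exp v ^ 2 := by
    rcases eq_or_ne c 0 with rfl | hc
    · have : s ^ 2 = 1 := by linarith
      rw [this]; positivity
    · positivity
  have hre : (rotation c s h • verticalLine v).re =
      s * c * (1 - Real.exp v ^ 2) / (c ^ 2 + s ^ 2 * Real.exp v ^ 2) := by
    rw [← UpperHalfPlane.coe_re, UpperHalfPlane.coe_specialLinearGroup_apply]
    simp [rotation, verticalLine, Complex.div_re, Complex.normSq_apply]
    field_simp
    ring
  have him : (rotation c s h • verticalLine v).im =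
      Real.exp v / (c ^ 2 + s ^ 2 * Real.exp v ^ 2) := by
    rw [← UpperHalfPlane.coe_im, UpperHalfPlane.coe_specialLinearGroup_apply]
    simp [rotation, verticalLine, Complex.div_im, Complex.normSq_apply]
    field_simp
    linear_combination h / (c ^ 2 + s ^ 2 * Real.exp v ^ 2)
  have hre0 : (verticalLine u).re = 0 := rfl
  have him0 : (verticalLine u).im = Real.exp u := rfl
  rw [UpperHalfPlane.cosh_dist', hre, him, hre0, him0, Real.cosh_eq, Real.cosh_eq]
  simp only [Real.exp_add, Real.exp_sub, Real.exp_neg, neg_sub, neg_add]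
  have hs : s ^ 2 = 1 - c ^ 2 := by linarith
  field_simp
  simp only [hs]
  ring_nf
  simp only [hs]
  ring

theorem cosh_one_ge : (3 / 2 : ℝ) ≤ Real.cosh 1 := by
  have h := Real.cosh_two_mul (1 / 2)
  have h1 : (1 / 2 : ℝ) ≤ Real.sinh (1 / 2) := Real.self_le_sinh_iff.2 (by norm_num)
  have h2 := Real.cosh_sq (1 / 2)
  rw [show (2 : ℝ) * (1 / 2) = 1 by norm_num] at h
  nlinarith

theorem sinh_mul_exp_le {p g : ℝ} (hg : 0 ≤ g) :
    Real.sinh p * Real.exp g ≤ Real.sinh (p + g) := by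
  have h : Real.exp (-g) ≤ Real.exp g := Real.exp_le_exp.2 (by linarith)
  have h1 := mul_le_mul_of_nonneg_left h (Real.exp_pos (-p)).le
  rw [Real.sinh_eq, Real.sinh_eq, neg_add, Real.exp_add, Real.exp_add]
  linarith

/-- Any triangle with side lengths `a`, `b`, `c` in the hyperbolic plane can be placed with one
vertex at `i` and one side vertical, and is thin with constant `1`. -/
theorem exists_rotation_thin {a b c : ℝ} (hab : a ≤ b + c) (hba : b ≤ a + c)
    (ha : 0 < a) (hb : 0 < b) (hc : c ≤ a + b) :
    ∃ A : Matrix.SpecialLinearGroup (Fin 2) ℝ, A • verticalLine 0 = verticalLine 0 ∧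
      dist (verticalLine a) (A • verticalLine b) = c ∧
      ∀ s, 0 ≤ s → s ≤ (a + b - c) / 2 → dist (verticalLine s) (A • verticalLine s) ≤ 1 := by
  obtain ⟨G, rfl⟩ : ∃ G, c = a + b - 2 * G := ⟨(a + b - c) / 2, by ring⟩
  obtain ⟨P, rfl⟩ : ∃ P, a = P + G := ⟨a - G, by ring⟩
  obtain ⟨Q, rfl⟩ : ∃ Q, b = Q + G := ⟨b - G, by ring⟩
  have hP : 0 ≤ P := by linarith
  have hQ : 0 ≤ Q := by linarith
  have hG : 0 ≤ G := by linarith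
  -- `G`, `P`, `Q` are the Gromov products at the three vertices, and `l = sin² (θ/2)` by the
  -- half-angle formula. Since `l ≤ exp (-2G)`, for `s ≤ G` the law of cosines gives `1 + 2 l sinh²
  -- s ≤ 3/2 ≤ cosh 1`.
  set l := Real.sinh P * Real.sinh Q / (Real.sinh (P + G) * Real.sinh (Q + G)) with hl
  have hsa := Real.sinh_pos_iff.2 ha
  have hsb := Real.sinh_pos_iff.2 hb
  have hsP := Real.sinh_nonneg_iff.2 hP
  have hsQ := Real.sinh_nonneg_iff.2 hQ
  have hl0 : 0 ≤ l := by positivity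
  have hlmul : l * (Real.sinh (P + G) * Real.sinh (Q + G)) = Real.sinh P * Real.sinh Q :=
    div_mul_cancel₀ _ (by positivity)
  have hlG : l * (Real.exp G * Real.exp G) ≤ 1 := by
    rw [hl, div_mul_eq_mul_div, div_le_one (by positivity)]
    have := mul_le_mul (sinh_mul_exp_le (p := P) hG) (sinh_mul_exp_le (p := Q) hG)
      (by positivity) hsa.le
    linarith
  have hl1 : l ≤ 1 := by
    have : 1 ≤ Real.exp G := Real.one_le_exp hG
    nlinarith [one_le_mul_of_one_le_of_one_le this this]
  have hcs : √(1 - l) ^ 2 + √l ^ 2 = 1 := by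
    rw [Real.sq_sqrt (by linarith), Real.sq_sqrt hl0]; ring
  have hcosh (u v : ℝ) : Real.cosh (dist (verticalLine u) (rotation _ _ hcs • verticalLine v)) =
      Real.cosh (u - v) + l * (2 * (Real.sinh u * Real.sinh v)) := by
    rw [cosh_dist_rotation, Real.sq_sqrt (by linarith), Real.sq_sqrt hl0, Real.cosh_add,
      Real.cosh_sub]
    ring
  refine ⟨rotation _ _ hcs, rotation_smul_verticalLine_zero _ _ _, ?_, fun s hs0 hs => ?_⟩
  · have h := hcosh (P + G) (Q + G)
    have h2 : Real.cosh (P + G - (Q + G)) + l * (2 * (Real.sinh (P + G) * Real.sinh (Q + G))) =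
        Real.cosh (P + Q) := by
      rw [show P + G - (Q + G) = P - Q by ring, Real.cosh_add, Real.cosh_sub]
      linear_combination 2 * hlmul
    rw [h2] at h
    have := Real.cosh_le_cosh.1 h.le
    have h' := Real.cosh_le_cosh.1 h.ge
    rw [abs_of_nonneg dist_nonneg, abs_of_nonneg (by linarith)] at this h'
    linarith
  · have hs' : s ≤ G := by linarith
    have h : Real.sinh s ≤ Real.exp G / 2 := by
      rw [Real.sinh_eq]
      have := Real.exp_le_exp.2 hs'
      have := Real.exp_pos (-s)
      linarith
    have h0 := Real.sinh_nonneg_iff.2 hs0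
    have hss : Real.sinh s * Real.sinh s ≤ Real.exp G / 2 * (Real.exp G / 2) :=
      mul_le_mul h h h0 (by positivity)
    have hle : Real.cosh (dist (verticalLine s) (rotation _ _ hcs • verticalLine s)) ≤
        Real.cosh 1 := by
      rw [hcosh, sub_self, Real.cosh_zero]
      have := mul_le_mul_of_nonneg_left hss hl0
      have := cosh_one_ge
      linarith
    have := Real.cosh_le_cosh.1 hle
    rwa [abs_of_nonneg dist_nonneg, abs_one] at this

end CATProduct

/-! ### Gromov hyperbolicity of CAT(-1) spaces -/

namespace CATProduct

section Hyperbolic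

variable {X : Type*} [MetricSpace X]

theorem gromovProduct_comm (o x y : X) : gromovProduct o x y = gromovProduct o y x := by
  rw [gromovProduct, gromovProduct, dist_comm x y]; ring

theorem gromovProduct_nonneg (o x y : X) : 0 ≤ gromovProduct o x y := by
  have := dist_triangle_left x y o
  rw [gromovProduct]; linarith

theorem gromovProduct_le_left (o x y : X) : gromovProduct o x y ≤ dist o x := by
  have := dist_triangle o x y
  rw [gromovProduct]; linarith

theorem gromovProduct_le_right (o x y : X) : gromovProduct o x y ≤ dist o y := by
  rw [gromovProduct_comm]; exact gromovProduct_le_left o y x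

theorem gromovProduct_sub_dist_le (o x y y' : X) :
    gromovProduct o x y - dist y y' ≤ gromovProduct o x y' := by
  have h1 := dist_triangle_right o y y'
  have h2 := dist_triangle x y y'
  have h3 := dist_triangle o y' y
  rw [dist_comm y' y] at h3
  rw [gromovProduct, gromovProduct]; linarith

theorem gromovProduct_sub_dist_base_le (o o' x y : X) :
    gromovProduct o x y - dist o o' ≤ gromovProduct o' x y := by
  have h1 := dist_triangle o o' x
  have h2 := dist_triangle o o' y
  rw [gromovProduct, gromovProduct]; linarith

theorem gromovProduct_isometryEquiv (f : X ≃ᵢ X) (o x y : X) :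
    gromovProduct (f o) (f x) (f y) = gromovProduct o x y := by
  simp only [gromovProduct, f.dist_eq]

theorem IsGeodesic.dist_left {x y : X} {γ : ℝ → X} (h : IsGeodesic x y γ) {t : ℝ}
    (ht : t ∈ Icc (0 : ℝ) (dist x y)) : dist x (γ t) = t := by
  have := h.2.2 0 ⟨le_rfl, dist_nonneg⟩ t ht
  rwa [h.1, zero_sub, abs_neg, abs_of_nonneg ht.1] at this

theorem IsGeodesic.dist_right {x y : X} {γ : ℝ → X} (h : IsGeodesic x y γ) {t : ℝ}
    (ht : t ∈ Icc (0 : ℝ) (dist x y)) : dist (γ t) y = dist x y - t := by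
  have := h.2.2 t ht (dist x y) ⟨dist_nonneg, le_rfl⟩
  rwa [h.2.1, abs_sub_comm, abs_of_nonneg (by linarith [ht.2])] at this

theorem IsCATNegOne.dist_le_one (hX : IsCATNegOne X) {o x y : X} {α β : ℝ → X}
    (hα : IsGeodesic o x α) (hβ : IsGeodesic o y β) {s : ℝ} (hs : 0 ≤ s)
    (hs' : s ≤ gromovProduct o x y) : dist (α s) (β s) ≤ 1 := by
  have hsx := hs'.trans (gromovProduct_le_left o x y)
  have hsy := hs'.trans (gromovProduct_le_right o x y)
  -- A side of length zero at `o` forces `s = 0`; otherwise both sides are positive, as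
  -- `exists_rotation_thin` requires.
  rcases hs.eq_or_lt with rfl | hs0
  · simp [hα.1, hβ.1]
  obtain ⟨A, hA0, hAc, hA⟩ := exists_rotation_thin (dist_triangle_right o x y)
    (dist_triangle o x y) (hs0.trans_le hsx) (hs0.trans_le hsy) (dist_triangle_left x y o)
  have hA' : Isometry fun t => A • verticalLine t :=
    (isometry_smul UpperHalfPlane A).comp isometry_verticalLine
  have h1 := isometry_verticalLine.isGeodesic (dist_nonneg (x := o) (y := x))
  have h2 := hA'.isGeodesic (dist_nonneg (x := o) (y := y))
  simp only [hA0] at h2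
  have d1 : dist (verticalLine 0) (verticalLine (dist o x)) = dist o x := by
    rw [isometry_verticalLine.dist_eq, dist_zero_left, Real.norm_of_nonneg dist_nonneg]
  have d2 : dist (verticalLine 0) (A • verticalLine (dist o y)) = dist o y := by
    rw [← hA0, hA'.dist_eq (0 : ℝ), dist_zero_left, Real.norm_of_nonneg dist_nonneg]
  exact (hX.comparison o x y α β hα hβ _ _ _ _ _ d1 d2 hAc h1 h2 s ⟨hs, hsx⟩ s ⟨hs, hsy⟩).trans
    (hA s hs hs')

/-- Two geodesics with the same ends bound a triangle whose comparison triangle is a single segment.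
-/
theorem IsCATNegOne.eq_of_isGeodesic (hX : IsCATNegOne X) {x y : X} {α β : ℝ → X}
    (hα : IsGeodesic x y α) (hβ : IsGeodesic x y β) {s : ℝ} (hs : s ∈ Icc (0 : ℝ) (dist x y)) :
    α s = β s := by
  have h1 := isometry_verticalLine.isGeodesic (dist_nonneg (x := x) (y := y))
  have d1 : dist (verticalLine 0) (verticalLine (dist x y)) = dist x y := by
    rw [isometry_verticalLine.dist_eq, dist_zero_left, Real.norm_of_nonneg dist_nonneg]
  have := hX.comparison x y y α β hα hβ _ _ _ _ _ d1 d1 (by simp) h1 h1 s hs s hs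
  rw [dist_self] at this
  exact dist_le_zero.1 this

/-- CAT(-1) spaces are Gromov hyperbolic. -/
theorem IsCATNegOne.min_gromovProduct_le (hX : IsCATNegOne X) (o x y z : X) :
    min (gromovProduct o x y) (gromovProduct o y z) - 1 ≤ gromovProduct o x z := by
  obtain ⟨α, hα⟩ := hX.geodesic o x
  obtain ⟨β, hβ⟩ := hX.geodesic o y
  obtain ⟨γ, hγ⟩ := hX.geodesic o z
  set s := min (gromovProduct o x y) (gromovProduct o y z)
  have hs0 : 0 ≤ s := le_min (gromovProduct_nonneg _ _ _) (gromovProduct_nonneg _ _ _)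
  have hs1 : s ≤ gromovProduct o x y := min_le_left _ _
  have hs2 : s ≤ gromovProduct o y z := min_le_right _ _
  have h1 := hX.dist_le_one hα hβ hs0 hs1
  have h2 := hX.dist_le_one hβ hγ hs0 hs2
  have h3 := hα.dist_right ⟨hs0, hs1.trans (gromovProduct_le_left _ _ _)⟩
  have h4 := hγ.dist_right ⟨hs0, hs2.trans (gromovProduct_le_right _ _ _)⟩
  -- The path from `x` to `z` through `α s` and `γ s` has a middle leg of length at most 2.
  have h6 := dist_triangle (α s) (β s) (γ s)
  have h7 := dist_triangle4 x (α s) (γ s) z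
  rw [dist_comm x (α s)] at h7
  rw [gromovProduct]; linarith

theorem IsCATNegOne.le_gromovProduct (hX : IsCATNegOne X) {o x y z : X} {c : ℝ}
    (h1 : c + 1 ≤ gromovProduct o x y) (h2 : c + 1 ≤ gromovProduct o y z) :
    c ≤ gromovProduct o x z := by
  linarith [hX.min_gromovProduct_le o x y z, le_min h1 h2]

/-! ### Alignment and Gromov products -/

theorem IsCATNegOne.geodesicSegment_eq (hX : IsCATNegOne X) {x y : X} {γ : ℝ → X}
    (hγ : IsGeodesic x y γ) : geodesicSegment x y = γ '' Icc 0 (dist x y) := by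
  ext p
  constructor
  · rintro ⟨γ', hγ', t, ht, rfl⟩
    exact ⟨t, ht, hX.eq_of_isGeodesic hγ hγ' ht⟩
  · rintro ⟨t, ht, rfl⟩
    exact ⟨γ, hγ, t, ht, rfl⟩

theorem IsGeodesic.continuousOn {x y : X} {γ : ℝ → X} (hγ : IsGeodesic x y γ) :
    ContinuousOn γ (Icc 0 (dist x y)) := by
  have : LipschitzOnWith 1 γ (Icc 0 (dist x y)) :=
    LipschitzOnWith.of_dist_le_mul fun s hs t ht => by
      rw [hγ.2.2 s hs t ht, Real.dist_eq, NNReal.coe_one, one_mul]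
  exact this.continuousOn

theorem IsCATNegOne.exists_isNearestPoint (hX : IsCATNegOne X) (w x y : X) :
    ∃ p, IsNearestPoint (geodesicSegment x y) w p := by
  obtain ⟨γ, hγ⟩ := hX.geodesic x y
  rw [hX.geodesicSegment_eq hγ]
  have hc : IsCompact (γ '' Icc 0 (dist x y)) := isCompact_Icc.image_of_continuousOn hγ.continuousOn
  have hne : (γ '' Icc 0 (dist x y)).Nonempty := ⟨_, 0, ⟨le_rfl, dist_nonneg⟩, rfl⟩
  obtain ⟨p, hp, hmin⟩ := hc.exists_isMinOn hne (continuous_const.dist continuous_id).continuousOn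
  exact ⟨p, hp, fun q hq => hmin hq⟩

/-- At time `G = (w | y)_x` the sides from `x` are within 1, so `[x, y]` comes within `d(x, w) - G +
1` of `w`, while the nearest point is farther than `d(x, w) - K`. -/
theorem IsCATNegOne.gromovProduct_le_of_alignedLeft (hX : IsCATNegOne X) {K : ℝ} {w x y : X}
    (h : AlignedLeft K w x y) : gromovProduct x w y ≤ K + 1 := by
  obtain ⟨p, ⟨-, hmin⟩, hpx⟩ := h
  obtain ⟨α, hα⟩ := hX.geodesic x w
  obtain ⟨β, hβ⟩ := hX.geodesic x y
  have hG := gromovProduct_nonneg x w y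
  have h1 := hX.dist_le_one hα hβ hG le_rfl
  have h2 := hα.dist_right ⟨hG, gromovProduct_le_left _ _ _⟩
  have h3 := hmin _ ⟨β, hβ, _, ⟨hG, gromovProduct_le_right _ _ _⟩, rfl⟩
  have h4 := dist_triangle w (α (gromovProduct x w y)) (β (gromovProduct x w y))
  have h5 := dist_triangle w p x
  rw [dist_comm w (α _)] at h4
  rw [dist_comm w x] at h5
  linarith

theorem IsCATNegOne.alignedLeft_of_gromovProduct_le (hX : IsCATNegOne X) {C : ℝ} {w x y : X}
    (h : gromovProduct x w y ≤ C) : AlignedLeft (2 * C + 3) w x y := by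
  obtain ⟨p, hp⟩ := hX.exists_isNearestPoint w x y
  refine ⟨p, hp, ?_⟩
  obtain ⟨⟨γ, hγ, t, ht, rfl⟩, hmin⟩ := hp
  have h1 : dist w (γ t) ≤ dist w x := hmin _ ⟨γ, hγ, 0, ⟨le_rfl, dist_nonneg⟩, hγ.1⟩
  have h2 := hγ.dist_left ht
  have h3 := hγ.dist_right ht
  -- The nearest point `γ t` is no farther from `w` than `x` is. Hyperbolicity through `γ t` then
  -- gives `t / 2 - 1 ≤ C`.
  have h4 : t / 2 ≤ gromovProduct x w (γ t) := by
    rw [gromovProduct, h2, dist_comm x w]; linarith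
  have h5 : t / 2 ≤ gromovProduct x (γ t) y := by
    rw [gromovProduct, h2, h3]; linarith [ht.1]
  have := hX.le_gromovProduct (c := t / 2 - 1) (by simpa using h4) (by simpa using h5)
  rw [dist_comm, h2]; linarith

/-! ### Limits in the boundary -/

theorem gromovProduct_ray {γ : ℝ≥0 → X} (hγ : Isometry γ) {o : X} (ho : γ 0 = o) {s t : ℝ≥0}
    (hst : s ≤ t) : gromovProduct o (γ s) (γ t) = s := by
  have hst' : (s : ℝ) ≤ t := hst
  subst ho
  simp only [gromovProduct, hγ.dist_eq, NNReal.dist_eq, NNReal.coe_zero, zero_sub, abs_neg,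
    NNReal.abs_eq]
  rw [abs_of_nonpos (by linarith)]
  ring

/-- Along an ultrafilter, a sequence tending to infinity in a proper geodesic space follows a
geodesic ray. -/
theorem exists_ray_of_tendsto [ProperSpace X] (hX : ∀ x y : X, ∃ γ : ℝ → X, IsGeodesic x y γ)
    (U : Ultrafilter ℕ) (o : X) (u : ℕ → X) (hu : Tendsto (fun n => dist o (u n)) U atTop) :
    ∃ γ : GeodesicRay X, γ.1 0 = o ∧
      ∀ T : ℝ≥0, ∀ᶠ n in U, (T : ℝ) - 1 ≤ gromovProduct o (u n) (γ.1 T) := by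
  choose α hα using fun n => hX o (u n)
  have hmem (T : ℝ≥0) : ∀ᶠ n in U, (T : ℝ) ∈ Icc (0 : ℝ) (dist o (u n)) :=
    (hu.eventually_ge_atTop (T : ℝ)).mono fun n hn => ⟨T.2, hn⟩
  -- Compact balls give a limit along `U` at every time at once, with no diagonal extraction.
  have hlim (T : ℝ≥0) : ∃ p, Tendsto (fun n => α n T) U (nhds p) := by
    have hc : IsCompact (Metric.closedBall o (T : ℝ)) := isCompact_closedBall o T
    obtain ⟨p, -, hp⟩ := hc.ultrafilter_le_nhds (U.map fun n => α n T) (by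
      rw [le_principal_iff, Ultrafilter.mem_coe, Ultrafilter.mem_map]
      filter_upwards [hmem T] with n hn
      rw [mem_preimage, Metric.mem_closedBall, dist_comm, (hα n).dist_left hn])
    exact ⟨p, hp⟩
  choose γ hγ using hlim
  have hiso : Isometry γ := Isometry.of_dist_eq fun s t => by
    refine tendsto_nhds_unique ((hγ s).dist (hγ t)) (tendsto_const_nhds.congr' ?_)
    filter_upwards [hmem s, hmem t] with n hs ht
    rw [(hα n).2.2 _ hs _ ht, NNReal.dist_eq]
  refine ⟨⟨γ, hiso⟩, ?_, fun T => ?_⟩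
  · refine tendsto_nhds_unique (hγ 0) (tendsto_const_nhds.congr fun n => ?_)
    rw [NNReal.coe_zero, (hα n).1]
  · filter_upwards [hmem T, (hγ T).eventually (Metric.ball_mem_nhds _ one_pos)] with n hn hb
    have h1 := gromovProduct_sub_dist_le o (u n) (α n T) (γ T)
    have h2 : gromovProduct o (u n) (α n T) = T := by
      rw [gromovProduct, (hα n).dist_left hn, dist_comm (u n), (hα n).dist_right hn]; ring
    linarith

/-- Control at the diagonal times suffices: `(γ n | γ t)_o = min n t`, so hyperbolicity passes from
`γ n` to `γ t`. Changing the ray and the base point costs a constant. -/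
theorem IsCATNegOne.convergesTo (hX : IsCATNegOne X) {o : X} {u : ℕ → X} {γ : GeodesicRay X}
    (h0 : γ.1 0 = o) (h : ∀ N : ℕ, (N : ℝ) - 1 ≤ gromovProduct o (u N) (γ.1 N)) :
    ConvergesTo u (Quotient.mk (rayAsymptotic X) γ) := by
  intro o' γ' hγ'
  obtain ⟨C, hC⟩ : (rayAsymptotic X).r γ' γ := Quotient.exact hγ'
  have key (n : ℕ) (t : ℝ≥0) :
      min ((n : ℝ) - 1) t - 1 - C - dist o o' ≤ gromovProduct o' (u n) (γ'.1 t) := by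
    have h1 : min (n : ℝ) t ≤ gromovProduct o (γ.1 n) (γ.1 t) := by
      rcases le_total (n : ℝ≥0) t with hnt | hnt
      · rw [gromovProduct_ray γ.2 h0 hnt, NNReal.coe_natCast]; exact min_le_left _ _
      · rw [gromovProduct_comm, gromovProduct_ray γ.2 h0 hnt]; exact min_le_right _ _
    have h1' : min ((n : ℝ) - 1) t ≤ gromovProduct o (γ.1 n) (γ.1 t) :=
      (min_le_min_right _ (by linarith)).trans h1
    have h2 : min ((n : ℝ) - 1) t ≤ gromovProduct o (u n) (γ.1 n) := (min_le_left _ _).trans (h n)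
    have h3 := hX.le_gromovProduct (c := min ((n : ℝ) - 1) t - 1) (by linarith)
      (by linarith : _ ≤ gromovProduct o (γ.1 n) (γ.1 t)) (x := u n)
    have h4 := gromovProduct_sub_dist_le o (u n) (γ.1 t) (γ'.1 t)
    have h5 := gromovProduct_sub_dist_base_le o o' (u n) (γ'.1 t)
    have h6 := hC t
    rw [dist_comm] at h6
    linarith
  rw [tendsto_atTop]
  intro R
  obtain ⟨N, hN⟩ := exists_nat_ge (R + 2 + C + dist o o')
  filter_upwards [(eventually_ge_atTop N).prod_mk (eventually_ge_atTop (N : ℝ≥0))] with p hp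
  have hp1 : (N : ℝ) ≤ p.1 := by exact_mod_cast hp.1
  have hp2 : (N : ℝ) ≤ p.2 := by exact_mod_cast hp.2
  have h1 : R + 1 + C + dist o o' ≤ min ((p.1 : ℝ) - 1) p.2 := le_min (by linarith) (by linarith)
  linarith [key p.1 p.2]

end Hyperbolic

end CATProduct

/-! ### Transverse subgroups: comparing the factors -/

namespace CATProduct

section Transverse

variable {r : ℕ} {X : Fin r → Type*} [∀ i, MetricSpace (X i)]

theorem IsTransverse.finite {Γ : Subgroup (∀ i, X i ≃ᵢ X i)} (hΓ : IsTransverse Γ) (z : ∀ i, X i)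
    (i : Fin r) (R : ℝ) : {g | g ∈ Γ ∧ dist (g i (z i)) (z i) ≤ R}.Finite := by
  by_contra hinf
  let e := Set.Infinite.natEmbedding _ hinf
  have h := hΓ.divergent (fun n => (e n).1) (fun n => (e n).2.1)
    (Subtype.val_injective.comp e.injective) z i
  obtain ⟨n, hn⟩ := (h.eventually_gt_atTop R).exists
  exact absurd (e n).2.2 (not_le.2 hn)

/-- Only finitely many elements move `z j` by at most `R`, and these move `z i` a bounded amount. -/
theorem IsTransverse.tendsto_dist {Γ : Subgroup (∀ i, X i ≃ᵢ X i)} (hΓ : IsTransverse Γ)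
    (z : ∀ i, X i) {a : ℕ → ∀ i, X i ≃ᵢ X i} (ha : ∀ n, a n ∈ Γ) {i : Fin r}
    (h : Tendsto (fun n => dist (z i) (a n i (z i))) atTop atTop) (j : Fin r) :
    Tendsto (fun n => dist (z j) (a n j (z j))) atTop atTop := by
  rw [tendsto_atTop]
  intro R
  obtain ⟨M, hM⟩ := ((hΓ.finite z j R).image fun g => dist (z i) (g i (z i))).bddAbove
  filter_upwards [h.eventually_gt_atTop M] with n hn
  by_contra hlt
  exact absurd (hM ⟨a n, ⟨ha n, by rw [dist_comm]; linarith⟩, rfl⟩) (not_le.2 hn)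

theorem gromovProduct_orbit (i : Fin r) (z : ∀ i, X i) (g h k : ∀ i, X i ≃ᵢ X i) :
    gromovProduct (g i (z i)) (h i (z i)) (k i (z i)) =
      gromovProduct (z i) ((g⁻¹ * h) i (z i)) ((g⁻¹ * k) i (z i)) := by
  have hc (f : ∀ i, X i ≃ᵢ X i) : g i ((g⁻¹ * f) i (z i)) = f i (z i) := by
    rw [← IsometryEquiv.mul_apply, ← Pi.mul_apply, mul_inv_cancel_left]
  rw [← gromovProduct_isometryEquiv (g i) (z i), hc, hc]

variable [∀ i, ProperSpace (X i)]

/-- If a Gromov product of two orbit points is bounded in one factor, it is bounded in every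
factor. -/
theorem IsTransverse.exists_gromovProduct_le (hX : ∀ i, IsCATNegOne (X i))
    {Γ : Subgroup (∀ i, X i ≃ᵢ X i)} (hΓ : IsTransverse Γ) (z : ∀ i, X i) (i₀ : Fin r) (K : ℝ)
    (i : Fin r) : ∃ C : ℝ, ∀ a ∈ Γ, ∀ b ∈ Γ,
      gromovProduct (z i₀) (a i₀ (z i₀)) (b i₀ (z i₀)) ≤ K →
        gromovProduct (z i) (a i (z i)) (b i (z i)) ≤ C := by
  by_contra! hcon
  choose a ha b hb hK hn using fun n : ℕ => hcon n
  have hprod : Tendsto (fun n => gromovProduct (z i) (a n i (z i)) (b n i (z i))) atTop atTop :=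
    tendsto_atTop_mono (fun n => (hn n).le) tendsto_natCast_atTop_atTop
  have hda := hΓ.tendsto_dist z ha
    (tendsto_atTop_mono (fun n => gromovProduct_le_left _ _ _) hprod)
  have hdb := hΓ.tendsto_dist z hb
    (tendsto_atTop_mono (fun n => gromovProduct_le_right _ _ _) hprod)
  let U : Ultrafilter ℕ := hyperfilter ℕ
  have hU : (U : Filter ℕ) ≤ atTop := Nat.hyperfilter_le_atTop
  choose γ hγ0 hγ using fun j => exists_ray_of_tendsto (hX j).geodesic U (z j)
    (fun n => a n j (z j)) ((hda j).mono_left hU)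
  choose δ hδ0 hδ using fun j => exists_ray_of_tendsto (hX j).geodesic U (z j)
    (fun n => b n j (z j)) ((hdb j).mono_left hU)
  -- Finitely many conditions that hold along `U` share an index; this turns ultrafilter limits into
  -- limits of sequences.
  have hφ (N : ℕ) : ∃ n, (∀ j, (N : ℝ) - 1 ≤ gromovProduct (z j) (a n j (z j)) ((γ j).1 N)) ∧
      ∀ j, (N : ℝ) - 1 ≤ gromovProduct (z j) (b n j (z j)) ((δ j).1 N) :=
    ((eventually_all.2 fun j => by simpa using hγ j N).and
      (eventually_all.2 fun j => by simpa using hδ j N)).exists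
  choose φ hφa hφb using hφ
  have hca (j : Fin r) := (hX j).convergesTo (u := fun N => a (φ N) j (z j)) (hγ0 j)
    (fun N => hφa N j)
  have hcb (j : Fin r) := (hX j).convergesTo (u := fun N => b (φ N) j (z j)) (hδ0 j)
    (fun N => hφb N j)
  have hne : (fun j => Quotient.mk (rayAsymptotic (X j)) (γ j) : ∀ j, Boundary (X j)) ≠
      fun j => Quotient.mk (rayAsymptotic (X j)) (δ j) := by
    intro heq
    -- With a common limit in factor `i₀`, both orbits would follow the ray `γ i₀`, and their
    -- product would exceed `K`.
    have h1 := hca i₀ (z i₀) (γ i₀) rfl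
    have h2 := hcb i₀ (z i₀) (γ i₀) (congrFun heq i₀)
    obtain ⟨p, hp1, hp2⟩ := ((h1.eventually_ge_atTop (K + 2)).and
      (h2.eventually_ge_atTop (K + 2))).exists
    rw [gromovProduct_comm] at hp2
    have := (hX i₀).le_gromovProduct (c := K + 1) (by linarith) (by linarith : _ ≤
      gromovProduct (z i₀) ((γ i₀).1 p.2) (b (φ p.1) i₀ (z i₀))) (x := a (φ p.1) i₀ (z i₀))
    linarith [hK (φ p.1)]
  -- Chaining `γ T`, `a n z`, `b n z`, `δ T` in factor `i` gives a product of at least `T - 3`. Both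
  -- ends are at distance `T` from `z i`, hence within 6 of each other.
  refine hΓ.antipodal _ ⟨z, fun N => a (φ N), fun N => ha _, hca⟩ _
    ⟨z, fun N => b (φ N), fun N => hb _, hcb⟩ hne i (Quotient.sound ⟨6, fun T => ?_⟩)
  obtain ⟨n, h1, h2, h3⟩ := ((hγ i T).and ((hδ i T).and
    (hU (hprod.eventually_ge_atTop (T : ℝ))))).exists
  rw [gromovProduct_comm] at h1
  have h4 := (hX i).le_gromovProduct (c := (T : ℝ) - 2) (x := (γ i).1 T) (by linarith)
    (by linarith : _ ≤ gromovProduct (z i) (a n i (z i)) (b n i (z i)))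
  have h5 := (hX i).le_gromovProduct (c := (T : ℝ) - 3) (by linarith)
    (by linarith : _ ≤ gromovProduct (z i) (b n i (z i)) ((δ i).1 T)) (x := (γ i).1 T)
  have h6 : dist (z i) ((γ i).1 T) = T := by
    rw [← hγ0 i, (γ i).2.dist_eq, NNReal.dist_eq]; simp
  have h7 : dist (z i) ((δ i).1 T) = T := by
    rw [← hδ0 i, (δ i).2.dist_eq, NNReal.dist_eq]; simp
  rw [gromovProduct, h6, h7] at h5
  linarith

end Transverse

end CATProduct

/-! ### The proposition -/

theorem mainTheorem12 {r : ℕ} [NeZero r] {X : Fin r → Type*} [∀ i, MetricSpace (X i)]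
    [∀ i, ProperSpace (X i)] (hX : ∀ i, CATProduct.IsCATNegOne (X i))
    (Γ : Subgroup (∀ i, X i ≃ᵢ X i)) (hΓ : CATProduct.IsTransverse Γ) (z : ∀ i, X i) :
    ∀ K : ℝ, 0 < K → ∃ C : ℝ, 0 < C ∧ ∀ g ∈ Γ, ∀ h ∈ Γ, ∀ k ∈ Γ,
      CATProduct.Aligned K (z 0) (g 0 (z 0)) (h 0 (z 0)) (k 0 (z 0)) →
        CATProduct.ProdAligned C z (fun i => g i (z i)) (fun i => h i (z i))
          (fun i => k i (z i)) := by
  intro K _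
  choose C hC using hΓ.exists_gromovProduct_le hX z 0 (K + 1)
  obtain ⟨M, hM⟩ := (Set.finite_range C).bddAbove
  have key (g h k : ∀ i, X i ≃ᵢ X i) (hg : g ∈ Γ) (hh : h ∈ Γ) (hk : k ∈ Γ)
      (hal : CATProduct.AlignedLeft K (k 0 (z 0)) (g 0 (z 0)) (h 0 (z 0))) (i : Fin r) :
      CATProduct.AlignedLeft (2 * max M 0 + 3) (k i (z i)) (g i (z i)) (h i (z i)) := by
    refine (hX i).alignedLeft_of_gromovProduct_le
      (le_trans ?_ ((hM ⟨i, rfl⟩).trans (le_max_left M 0)))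
    have h0 := (hX 0).gromovProduct_le_of_alignedLeft hal
    rw [CATProduct.gromovProduct_orbit] at h0 ⊢
    exact hC i _ (Γ.mul_mem (Γ.inv_mem hg) hk) _ (Γ.mul_mem (Γ.inv_mem hg) hh) h0
  refine ⟨2 * max M 0 + 3, by positivity, fun g hg h hh k hk hal i => ⟨?_, ?_⟩⟩
  -- The point `z` is the orbit point of `1`; the other half of alignment reverses the segment,
  -- exchanging `g` and `h`.
  · exact key g h 1 hg hh Γ.one_mem hal.1 i
  · exact key h g k hh hg hk hal.2 i
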